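/- **Definitions.** Let $V$ be a finite set and let $K$ be a simplicial complex on the vertex set $V$, i.e. a collection of finite subsets of $V$ closed under passing to subsets and containing $\varnothing$ (elements of $V$ need not be vertices of $K$). Let $\mathrm{cat}(K)$ be its face poset (including $\varnothing$), regarded as a category. For pointed spaces $X_i$ and maps $f_i\colon X_i\to A_i$ of pointed spaces ($i\in V$), the *polyhedral coproduct* is the homotopy limit $$\underline f^K_{\mathrm{co}}=\operatorname{holim}_{\mathrm{cat}(K)^{\mathrm{op}}} D,\qquad D(\sigma)=\bigvee_{i\in V}Y_i(\sigma),\qquad Y_i(\sigma)=\begin{cases}X_i & i\in\sigma\\ A_i& i\notin\sigma,\end{cases}$$ where for $\tau\subseteq\sigma$ the map $D(\sigma)\to D(\tau)$ is the wedge of the maps $f_i$ for $i\in\sigma\setminus\tau$ and of identity maps for the other $i$. Here $\operatorname{holim}_{C}D$ is the Bousfield–Kan homotopy limit, the space of natural families of maps $|N(C/c)|\to D(c)$, $c\in C$. If every $A_i$ is a point and every $f_i$ is the constant map, one writes $(\underline X,\underline *)^K_{\mathrm{co}}$ for $\underline f^K_{\mathrm{co}}$. **Theorem.** Let $K_1$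 and $K_2$ be simplicial complexes on finite vertex sets $V_1$ and $V_2$, let $K=K_1\sqcup K_2$ be their disjoint union, on the vertex set $V_1\sqcup V_2$, and let $X_i$ be a pointed topological space for each $i\in V_1\sqcup V_2$. Then there is a (base point preserving) homotopy equivalence $$(\underline X,\underline *)^K_{\mathrm{co}}\;\simeq\;(\underline X,\underline *)^{K_1}_{\mathrm{co}}\times(\underline X,\underline *)^{K_2}_{\mathrm{co}},$$ where on the right the families are $(X_i)_{i\in V_1}$ and $(X_i)_{i\in V_2}$. -/

import Mathlib

open CategoryTheory

universe u v w

/-- A pointed topological space. -/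
structure PtdTop : Type (u + 1) where
  carrier : Type u
  [top : TopologicalSpace carrier]
  pt : carrier

namespace PtdTop

instance : CoeSort PtdTop.{u} (Type u) := ⟨PtdTop.carrier⟩

instance (X : PtdTop.{u}) : TopologicalSpace X := X.top

/-- A morphism of pointed spaces: a continuous map that preserves the base point. -/
@[ext]
structure Hom (X : PtdTop.{u}) (Y : PtdTop.{v}) where
  map : C(X, Y)
  map_pt : map X.pt = Y.pt

/-- The identity map. -/
def Hom.id (X : PtdTop.{u}) : Hom X X := ⟨ContinuousMap.id X, rfl⟩

/-- The composite `g ∘ f`. -/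
def Hom.comp {X : PtdTop.{u}} {Y : PtdTop.{v}} {Z : PtdTop.{w}} (g : Hom Y Z) (f : Hom X Y) :
    Hom X Z :=
  ⟨g.map.comp f.map, by simp [f.map_pt, g.map_pt]⟩

/-- The category of pointed topological spaces. -/
instance : Category PtdTop.{u} where
  Hom X Y := PtdTop.Hom X Y
  id X := Hom.id X
  comp f g := Hom.comp g f

/-- The one-point space. -/
def point : PtdTop.{u} := ⟨PUnit, PUnit.unit⟩

/-- The constant map to the one-point space. -/
def toPoint (X : PtdTop.{u}) : X ⟶ point.{u} :=
  Hom.mk (ContinuousMap.const X PUnit.unit) rfl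

/-- The cartesian product of two pointed spaces. -/
def prod (X : PtdTop.{u}) (Y : PtdTop.{v}) : PtdTop.{max u v} := ⟨X × Y, (X.pt, Y.pt)⟩

/-- `X ≃ Y`: there are mutually inverse maps of pointed spaces, up to base point preserving
homotopy. -/
def HomotopyEquivalent (X : PtdTop.{u}) (Y : PtdTop.{v}) : Prop :=
  ∃ (f : Hom X Y) (g : Hom Y X),
    ((g.comp f).map).HomotopicRel (ContinuousMap.id X) {X.pt} ∧
      ((f.comp g).map).HomotopicRel (ContinuousMap.id Y) {Y.pt}

section Wedge

variable {ι : Type w}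

/-- The relation on `{*} ⊔ ⨆ᵢ Xᵢ` that glues all base points to `*`. The extra point `*` only
matters for an empty family, whose wedge is a point. -/
inductive WedgeRel (X : ι → PtdTop.{u}) :
    PUnit.{1} ⊕ (Σ i, X i) → PUnit.{1} ⊕ (Σ i, X i) → Prop
  | glue (i : ι) : WedgeRel X (Sum.inl PUnit.unit) (Sum.inr ⟨i, (X i).pt⟩)

/-- The wedge `⋁ᵢ Xᵢ` of a family of pointed spaces, with the quotient topology. -/
def wedge (X : ι → PtdTop.{u}) : PtdTop.{max u w} where
  carrier := Quot (WedgeRel X)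
  top := inferInstance
  pt := Quot.mk _ (Sum.inl PUnit.unit)

/-- The map `⋁ᵢ Xᵢ → ⋁ᵢ Yᵢ` induced by maps `Xᵢ → Yᵢ`. -/
def wedgeMap {X Y : ι → PtdTop.{u}} (f : ∀ i, X i ⟶ Y i) : wedge X ⟶ wedge Y :=
  Hom.mk
    ⟨Quot.map (Sum.map id (Sigma.map id fun i => (f i).map)) (by
        rintro _ _ ⟨i⟩
        have h : (f i).map (X i).pt = (Y i).pt := (f i).map_pt
        simp only [Sum.map_inl, Sum.map_inr, Sigma.map, id, h]
        exact WedgeRel.glue i),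
      continuous_quot_lift _ (continuous_quot_mk.comp
        (continuous_id.sumMap (Continuous.sigma_map fun i => (f i).map.continuous)))⟩
    rfl

theorem wedgeMap_id (X : ι → PtdTop.{u}) : wedgeMap (fun i => 𝟙 (X i)) = 𝟙 (wedge X) := by
  apply Hom.ext
  ext x
  obtain ⟨x | ⟨i, x⟩, rfl⟩ := Quot.exists_rep x <;> rfl

theorem wedgeMap_comp {X Y Z : ι → PtdTop.{u}} (f : ∀ i, X i ⟶ Y i) (g : ∀ i, Y i ⟶ Z i) :
    wedgeMap (fun i => f i ≫ g i) = wedgeMap f ≫ wedgeMap g := by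
  apply Hom.ext
  ext x
  obtain ⟨x | ⟨i, x⟩, rfl⟩ := Quot.exists_rep x <;> rfl

end Wedge

section Holim

variable {C : Type u} [Category.{v} C]

/-- The geometric realisation of the nerve of the over category `C / c`. -/
noncomputable def overNerve (c : C) : TopCat := SSet.toTop.obj (nerve (Over c))

/-- The map `|N(C / c)| → |N(C / d)|` induced by a morphism `c ⟶ d`. -/
noncomputable def overNerveMap {c d : C} (g : c ⟶ d) : overNerve c ⟶ overNerve d :=
  SSet.toTop.map (nerveMap (Over.map g))

/-- The homotopy limit of a diagram `D : C ⥤ Top_*`, by the formula of Bousfield and Kan: the space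
of natural families of maps `|N(C / c)| → D(c)`, with the topology induced from the product of the
mapping spaces (with the compact-open topology), based at the family of constant maps. -/
noncomputable def holim (D : C ⥤ PtdTop.{w}) : PtdTop where
  carrier := {φ : ∀ c : C, C(overNerve c, D.obj c) //
    ∀ (c d : C) (g : c ⟶ d) (x : overNerve c),
      φ d (overNerveMap g x) = (D.map g).map (φ c x)}
  top := inferInstance
  pt := ⟨fun c => ContinuousMap.const _ (D.obj c).pt, fun _ _ g _ => (D.map g).map_pt.symm⟩

end Holim

/-- `X` if the truth value is `true`, and `A` otherwise. -/
def select (X A : PtdTop.{u}) : Bool → PtdTop.{u}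
  | true => X
  | false => A

/-- For truth values `q ≤ p`, the map `select X A p ⟶ select X A q`: it is `f` if `p` is true and `q`
is false, and an identity map otherwise. -/
def selectMap {X A : PtdTop.{u}} (f : X ⟶ A) :
    ∀ p q : Bool, q ≤ p → (select X A p ⟶ select X A q)
  | true, true, _ => 𝟙 X
  | true, false, _ => f
  | false, false, _ => 𝟙 A
  | false, true, h => absurd h (by decide)

theorem selectMap_id {X A : PtdTop.{u}} (f : X ⟶ A) (p : Bool) :
    selectMap f p p le_rfl = 𝟙 (select X A p) := by
  cases p <;> rfl

theorem selectMap_comp {X A : PtdTop.{u}} (f : X ⟶ A) (p q r : Bool) (h : q ≤ p) (h' : r ≤ q) :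
    selectMap f p r (h'.trans h) = selectMap f p q h ≫ selectMap f q r h' := by
  cases p <;> cases q <;> cases r <;> first | rfl | exact absurd h (by decide) |
    exact absurd h' (by decide)

end PtdTop

namespace PreAbstractSimplicialComplex

variable {V : Type u}

/-- The face poset `cat(K)` of a simplicial complex, including the empty face. (The faces of a
`PreAbstractSimplicialComplex` are the nonempty ones.) -/
def Face (K : PreAbstractSimplicialComplex V) : Type u := {σ : Finset V // σ = ∅ ∨ σ ∈ K}

instance (K : PreAbstractSimplicialComplex V) : PartialOrder (Face K) :=
  inferInstanceAs (PartialOrder {σ : Finset V // σ = ∅ ∨ σ ∈ K})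

/-- The disjoint union `K₁ ⊔ K₂`, on the disjoint union of the two vertex sets. -/
def disjUnion {V₁ : Type u} {V₂ : Type v} [DecidableEq V₁] [DecidableEq V₂]
    (K₁ : PreAbstractSimplicialComplex V₁) (K₂ : PreAbstractSimplicialComplex V₂) :
    PreAbstractSimplicialComplex (V₁ ⊕ V₂) :=
  K₁.map Sum.inl ⊔ K₂.map Sum.inr

section Coproduct

variable [DecidableEq V] {X A : V → PtdTop.{w}} (f : ∀ i, X i ⟶ A i)
  (K : PreAbstractSimplicialComplex V)

/-- The diagram `D : cat(K)ᵒᵖ ⥤ Top_*`, `D(σ) = ⋁ᵢ Yᵢ(σ)`, with `Yᵢ(σ) = Xᵢ` if `i ∈ σ` and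
`Yᵢ(σ) = Aᵢ` otherwise; for `τ ⊆ σ` the map `D(σ) ⟶ D(τ)` is the wedge of the maps `fᵢ` for
`i ∈ σ \ τ` and of identity maps for the other `i`. -/
def coproductDiagram : (Face K)ᵒᵖ ⥤ PtdTop.{max w u} where
  obj σ := PtdTop.wedge fun i => PtdTop.select (X i) (A i) (decide (i ∈ σ.unop.1))
  map {σ τ} g := PtdTop.wedgeMap fun i =>
    PtdTop.selectMap (f i) (decide (i ∈ σ.unop.1)) (decide (i ∈ τ.unop.1))
      (by
        have h : τ.unop.1 ⊆ σ.unop.1 := leOfHom g.unop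
        simpa [Bool.le_iff_imp] using @h i)
  map_id σ := by
    simp only [PtdTop.selectMap_id]
    exact PtdTop.wedgeMap_id _
  map_comp g h := by
    rw [← PtdTop.wedgeMap_comp]
    congr 1
    funext i
    exact PtdTop.selectMap_comp _ _ _ _ _ _

/-- The polyhedral coproduct `f^K_co` of a family of maps `fᵢ : Xᵢ ⟶ Aᵢ` of pointed spaces. -/
noncomputable def polyhedralCoproduct : PtdTop.{max w u} :=
  PtdTop.holim (coproductDiagram f K)

end Coproduct

/-- The polyhedral coproduct `(X, *)^K_co`: the maps are the constant maps `Xᵢ ⟶ *`. -/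
noncomputable def polyhedralCoproductPt [DecidableEq V] (X : V → PtdTop.{w})
    (K : PreAbstractSimplicialComplex V) : PtdTop.{max w u} :=
  polyhedralCoproduct (fun i => (X i).toPoint) K

end PreAbstractSimplicialComplex

/-!
The two spaces are in fact homeomorphic. Let `D` be the diagram of `K = K₁ ⊔ K₂`. As the target of
every `Xᵢ` is a point, `D(∅)` is a wedge of points, so a point of the homotopy limit carries no
information at the empty face. A nonempty face `σ` of `K` lies in exactly one of `K₁` and `K₂`, say
in `K₁`, and so do all faces containing it. Hence the over category of `σ` is the same in `K` as in
`K₁`, and `D(σ)` is the corresponding wedge for `K₁` with additional trivial summands. So a natural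
family on `K` is the same as a pair of natural families on `K₁` and `K₂`.

To avoid identifying over categories face by face, the comparison maps are induced by functors on
whole face posets: the image functor from faces of `Kᵢ` to faces of `K` gives
`IsFullSubcomplex.restrict`, and the functor that intersects a face of `K` with `Kᵢ` gives
`IsFullSubcomplex.extend`. The map from the product extends both families to `K` and uses the first
on the faces meeting `V₁` and the second on the others (`coproductGlue`). By `holimMap_holimMap`,
extension followed by restriction is the identity (`restrict_extend`), and restriction followed by
extension is the identity at the nonempty faces on the relevant side (`extend_restrict_apply`).

As `V₁` and `V₂` may lie in different universes, the face posets do too, and the functoriality of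
`SSet.toTop` does not provide the maps between realisations of nerves. They come from the universal
property of `|S|` with respect to target spaces in arbitrary universes (`SSet.exists_desc`), which
follows from the adjunction with the singular simplicial set.
-/

/-! ### Continuous maps out of a geometric realisation -/

namespace SSet

/-- The standard topological simplex of dimension `n`. -/
abbrev topSimplex (n : SimplexCategoryᵒᵖ) : Type := _root_.stdSimplex ℝ (Fin (n.unop.len + 1))

/-- The unit `S ⟶ Sing |S|` of the adjunction between realisation and singular simplicial set. -/
noncomputable def toSingular (S : SSet.{u}) : S ⟶ TopCat.toSSet.obj (SSet.toTop.obj S) :=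
  sSetTopAdj.unit.app S

theorem toSingular_naturality {S T : SSet.{u}} (f : S ⟶ T) :
    f ≫ T.toSingular = S.toSingular ≫ TopCat.toSSet.map (SSet.toTop.map f) :=
  sSetTopAdj.unit.naturality f

/-- The characteristic map `Δⁿ → |S|` of an `n`-simplex of `S`. -/
noncomputable def simplexMap (S : SSet.{u}) {n : SimplexCategoryᵒᵖ} (s : S.obj n) :
    C(topSimplex n, SSet.toTop.obj S) :=
  (SSet.toTop.obj S).toSSetObjEquiv n (S.toSingular.app n s)

/-- The map of standard topological simplices induced by a morphism of `SimplexCategory`. -/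
noncomputable def topSimplexMap {n m : SimplexCategoryᵒᵖ} (θ : n ⟶ m) :
    C(topSimplex m, topSimplex n) :=
  ⟨_, _root_.stdSimplex.continuous_map θ.unop⟩

theorem toSSetObjEquiv_map (X : TopCat.{u}) {n m : SimplexCategoryᵒᵖ} (θ : n ⟶ m)
    (s : (TopCat.toSSet.obj X).obj n) :
    X.toSSetObjEquiv m ((TopCat.toSSet.obj X).map θ s) =
      (X.toSSetObjEquiv n s).comp (topSimplexMap θ) :=
  rfl

theorem toSSetObjEquiv_app {X Y : TopCat.{u}} (f : X ⟶ Y) {n : SimplexCategoryᵒᵖ}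
    (s : (TopCat.toSSet.obj X).obj n) :
    Y.toSSetObjEquiv n ((TopCat.toSSet.map f).app n s) = f.hom.comp (X.toSSetObjEquiv n s) :=
  rfl

theorem simplexMap_map (S : SSet.{u}) {n m : SimplexCategoryᵒᵖ} (θ : n ⟶ m) (s : S.obj n) :
    S.simplexMap (S.map θ s) = (S.simplexMap s).comp (topSimplexMap θ) := by
  rw [simplexMap, simplexMap, ← toSSetObjEquiv_map, NatTrans.naturality_apply]

theorem toTop_map_comp_simplexMap {S T : SSet.{u}} (f : S ⟶ T) {n : SimplexCategoryᵒᵖ}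
    (s : S.obj n) :
    (SSet.toTop.map f).hom.comp (S.simplexMap s) = T.simplexMap (f.app n s) := by
  have h : T.toSingular.app n (f.app n s) =
      (TopCat.toSSet.map (SSet.toTop.map f)).app n (S.toSingular.app n s) := by
    have h₀ := NatTrans.congr_app (toSingular_naturality f) n
    rw [NatTrans.comp_app, NatTrans.comp_app] at h₀
    exact ConcreteCategory.congr_hom h₀ s
  rw [simplexMap, simplexMap, ← toSSetObjEquiv_app, h]

/-- A compatible family of maps out of the simplices of `S` extends to `|S|`, for a target in the
same universe as `S`: it is a map from `S` to the singular simplicial set of the target. -/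
theorem exists_desc_aux (S : SSet.{u}) (Y : TopCat.{u})
    (h : ∀ n : SimplexCategoryᵒᵖ, S.obj n → C(topSimplex n, Y))
    (hh : ∀ (n m : SimplexCategoryᵒᵖ) (θ : n ⟶ m) (s : S.obj n),
      h m (S.map θ s) = (h n s).comp (topSimplexMap θ)) :
    ∃ f : SSet.toTop.obj S ⟶ Y, ∀ n (s : S.obj n), f.hom.comp (S.simplexMap s) = h n s := by
  let g : S ⟶ TopCat.toSSet.obj Y :=
    { app n := ↾fun s => (Y.toSSetObjEquiv n).symm (h n s)
      naturality n m θ := by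
        ext s
        apply (Y.toSSetObjEquiv m).injective
        refine Eq.trans (Equiv.apply_symm_apply _ _) ?_
        refine Eq.trans ?_ (toSSetObjEquiv_map Y θ _).symm
        refine Eq.trans (hh n m θ s) ?_
        exact congrArg (ContinuousMap.comp · (topSimplexMap θ))
          ((Y.toSSetObjEquiv n).apply_symm_apply (h n s)).symm }
  refine ⟨(sSetTopAdj.homEquiv S Y).symm g, fun n s => ?_⟩
  rw [simplexMap, ← toSSetObjEquiv_app]
  have := ConcreteCategory.congr_hom (congrArg (fun k => NatTrans.app k n) (
    (sSetTopAdj.homEquiv S Y).apply_symm_apply g)) s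
  rw [Adjunction.homEquiv_unit] at this
  refine (congrArg (Y.toSSetObjEquiv n) this).trans ?_
  exact (Y.toSSetObjEquiv n).apply_symm_apply (h n s)

/-- Uniqueness for `exists_desc_aux`. As the target lives in the universe of `S`, this is only a
step towards `continuousMap_ext`. -/
theorem toTop_hom_ext {S : SSet.{u}} {Y : TopCat.{u}} {f g : SSet.toTop.obj S ⟶ Y}
    (h : ∀ n (s : S.obj n), f.hom.comp (S.simplexMap s) = g.hom.comp (S.simplexMap s)) : f = g := by
  apply (sSetTopAdj.homEquiv S Y).injective
  ext n s
  apply (Y.toSSetObjEquiv n).injective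
  rw [Adjunction.homEquiv_unit, Adjunction.homEquiv_unit]
  exact h n s

/-- Every point of `|S|` lies in the image of a simplex. -/
theorem exists_simplexMap_eq {S : SSet.{u}} (x : SSet.toTop.obj S) :
    ∃ (n : SimplexCategoryᵒᵖ) (s : S.obj n) (t : topSimplex n), S.simplexMap s t = x := by
  -- The family of characteristic maps extends to a section of the inclusion of their joint image.
  let R : Set (SSet.toTop.obj S) := {x | ∃ (n : SimplexCategoryᵒᵖ) (s : S.obj n) (t : topSimplex n),
    S.simplexMap s t = x}
  obtain ⟨f, hf⟩ := exists_desc_aux S (TopCat.of R)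
    (fun n s => ⟨fun t => ⟨S.simplexMap s t, n, s, t, rfl⟩, by fun_prop⟩)
    (fun n m θ s => by
      ext t
      exact congrArg (fun k => k t) (simplexMap_map S θ s))
  let i : TopCat.of R ⟶ SSet.toTop.obj S := TopCat.ofHom ⟨Subtype.val, continuous_subtype_val⟩
  have hi : f ≫ i = 𝟙 _ := toTop_hom_ext fun n s => by
    ext t
    exact congrArg (fun k => (k t).1) (hf n s)
  have hx : i (f x) = x := congrArg (fun k : SSet.toTop.obj S ⟶ SSet.toTop.obj S => k x) hi
  rw [← hx]
  exact (f x).2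

theorem continuousMap_ext {S : SSet.{u}} {Y : Type w} [TopologicalSpace Y]
    {f g : C(SSet.toTop.obj S, Y)}
    (h : ∀ n (s : S.obj n), f.comp (S.simplexMap s) = g.comp (S.simplexMap s)) : f = g := by
  ext x
  obtain ⟨n, s, t, rfl⟩ := exists_simplexMap_eq x
  exact congrArg (fun k => k t) (h n s)

/-- A compatible family of maps out of the simplices of `S` extends to `|S|`, for a target in an
arbitrary universe. -/
theorem exists_desc (S : SSet.{u}) {Y : Type w} [TopologicalSpace Y]
    (h : ∀ n : SimplexCategoryᵒᵖ, S.obj n → C(topSimplex n, Y))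
    (hh : ∀ (n m : SimplexCategoryᵒᵖ) (θ : n ⟶ m) (s : S.obj n),
      h m (S.map θ s) = (h n s).comp (topSimplexMap θ)) :
    ∃ f : C(SSet.toTop.obj S, Y), ∀ n (s : S.obj n), f.comp (S.simplexMap s) = h n s := by
  -- The family factors through a quotient `Z` of the disjoint union of the simplices, which injects
  -- into `Y` and lives in the universe of `S`.
  let P : Type u := Σ n : SimplexCategoryᵒᵖ, S.obj n × topSimplex n
  let _ : ∀ n : SimplexCategoryᵒᵖ, TopologicalSpace (S.obj n) := fun _ => ⊥
  have : ∀ n : SimplexCategoryᵒᵖ, DiscreteTopology (S.obj n) := fun _ => ⟨rfl⟩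
  let k : P → Y := fun p => h p.1 p.2.1 p.2.2
  have hk : Continuous k := continuous_sigma fun n => continuous_prod_of_discrete_left.2
    fun s => (h n s).continuous
  let Z := Quotient (Setoid.ker k)
  let q : P → Z := Quotient.mk _
  have hq : Continuous q := continuous_quot_mk
  let j : C(Z, Y) := ⟨Quotient.lift k fun _ _ e => e, hk.quotient_lift _⟩
  have hj : Function.Injective j := by
    rintro ⟨a⟩ ⟨b⟩ e
    exact Quotient.sound e
  obtain ⟨f, hf⟩ := exists_desc_aux S (TopCat.of Z)
    (fun n s => ⟨fun t => q ⟨n, s, t⟩, hq.comp (continuous_sigmaMk.comp (by fun_prop))⟩)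
    (fun n m θ s => by
      ext t
      apply hj
      exact congrArg (fun k => k t) (hh n m θ s))
  refine ⟨j.comp f.hom, fun n s => ?_⟩
  rw [ContinuousMap.comp_assoc, hf]
  rfl

end SSet

/-! ### Functoriality of `|N(A)|` across universes -/

namespace CategoryTheory


noncomputable section

/-- The geometric realisation of the nerve of a category. -/
abbrev nerveTop (A : Type u) [Category.{v} A] : TopCat.{max u v} := SSet.toTop.obj (nerve A)

universe u₁ v₁ u₂ v₂ u₃ v₃
variable {A : Type u₁} [Category.{v₁} A] {B : Type u₂} [Category.{v₂} B]
  {C : Type u₃} [Category.{v₃} C]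

/-- The map on `n`-simplices of nerves induced by a functor between categories which may live in
different universes. -/
def nerveSimplexMap (F : A ⥤ B) {n : SimplexCategoryᵒᵖ} (s : (nerve A).obj n) : (nerve B).obj n :=
  (F.mapComposableArrows _).obj s

theorem exists_nerveTopMap (F : A ⥤ B) : ∃ f : C(nerveTop A, nerveTop B),
    ∀ n (s : (nerve A).obj n), f.comp ((nerve A).simplexMap s) =
      (nerve B).simplexMap (nerveSimplexMap F s) :=
  SSet.exists_desc _ _ fun _ _ θ s => (nerve B).simplexMap_map θ (nerveSimplexMap F s)

/-- The map `|N(A)| → |N(B)|` induced by a functor. As `A` and `B` may live in different universes,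
this is not a case of functoriality of `SSet.toTop`. -/
def nerveTopMap (F : A ⥤ B) : C(nerveTop A, nerveTop B) := (exists_nerveTopMap F).choose

theorem nerveTopMap_comp_simplexMap (F : A ⥤ B) {n : SimplexCategoryᵒᵖ} (s : (nerve A).obj n) :
    (nerveTopMap F).comp ((nerve A).simplexMap s) =
      (nerve B).simplexMap (nerveSimplexMap F s) :=
  (exists_nerveTopMap F).choose_spec n s

theorem nerveTopMap_id : nerveTopMap (𝟭 A) = ContinuousMap.id (nerveTop A) :=
  SSet.continuousMap_ext fun _ s => nerveTopMap_comp_simplexMap (𝟭 A) s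

theorem nerveTopMap_comp (F : A ⥤ B) (G : B ⥤ C) :
    nerveTopMap (F ⋙ G) = (nerveTopMap G).comp (nerveTopMap F) :=
  SSet.continuousMap_ext fun n s => by
    rw [ContinuousMap.comp_assoc, nerveTopMap_comp_simplexMap, nerveTopMap_comp_simplexMap,
      nerveTopMap_comp_simplexMap]
    rfl

/-- Within one universe, `nerveTopMap` is the functoriality of the realisation. -/
theorem toTop_map_nerveMap {A B : Type u} [Category.{v} A] [Category.{v} B] (F : A ⥤ B) :
    (SSet.toTop.map (nerveMap F)).hom = nerveTopMap F :=
  SSet.continuousMap_ext fun n s => by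
    rw [SSet.toTop_map_comp_simplexMap, nerveTopMap_comp_simplexMap]
    rfl

end

end CategoryTheory

namespace PtdTop

universe u₁ u₂ v₁ v₂ w₁ w₂

/-! ### Maps of pointed spaces -/

/-- Mutually inverse maps of pointed spaces form a homotopy equivalence. -/
theorem HomotopyEquivalent.of_inverse {X : PtdTop.{u}} {Y : PtdTop.{v}} (f : Hom X Y) (g : Hom Y X)
    (hgf : ∀ x, g.map (f.map x) = x) (hfg : ∀ y, f.map (g.map y) = y) : X.HomotopyEquivalent Y := by
  have h₁ : (g.comp f).map = ContinuousMap.id X := ContinuousMap.ext hgf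
  have h₂ : (f.comp g).map = ContinuousMap.id Y := ContinuousMap.ext hfg
  refine ⟨f, g, ?_, ?_⟩
  · rw [h₁]
    exact ContinuousMap.HomotopicRel.refl _
  · rw [h₂]
    exact ContinuousMap.HomotopicRel.refl _

/-- The constant map at the base point. -/
def Hom.const (X : PtdTop.{u}) (Y : PtdTop.{v}) : Hom X Y :=
  ⟨ContinuousMap.const X Y.pt, rfl⟩

/-- The map `X → Y × Z` with components `f` and `g`. -/
def Hom.pair {X : PtdTop.{u}} {Y : PtdTop.{v}} {Z : PtdTop.{w}} (f : Hom X Y) (g : Hom X Z) :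
    Hom X (Y.prod Z) :=
  ⟨f.map.prodMk g.map, Prod.ext f.map_pt g.map_pt⟩

/-- The product of two maps of pointed spaces. -/
def Hom.prodMap {X : PtdTop.{u₁}} {X' : PtdTop.{u₂}} {Y : PtdTop.{v₁}} {Y' : PtdTop.{v₂}}
    (f : Hom X Y) (g : Hom X' Y') : Hom (X.prod X') (Y.prod Y') :=
  ⟨f.map.prodMap g.map, Prod.ext f.map_pt g.map_pt⟩

/-! ### Maps out of a wedge -/

section Wedge

variable {ι : Type w}

/-- The inclusion of a summand into a wedge. -/
def wedgeIncl (X : ι → PtdTop.{u}) (i : ι) : Hom (X i) (wedge X) :=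
  ⟨⟨fun x => Quot.mk _ (Sum.inr ⟨i, x⟩),
    continuous_quot_mk.comp (continuous_inr.comp continuous_sigmaMk)⟩,
    (Quot.sound (WedgeRel.glue i)).symm⟩

/-- The map out of a wedge given by maps out of its summands. -/
def wedgeDesc {X : ι → PtdTop.{u}} {Z : PtdTop.{v}} (f : ∀ i, Hom (X i) Z) : Hom (wedge X) Z :=
  ⟨⟨Quot.lift (Sum.elim (fun _ => Z.pt) fun p => (f p.1).map p.2) (by
      rintro _ _ ⟨i⟩
      exact (f i).map_pt.symm),
    continuous_quot_lift _ (continuous_const.sumElim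
      (continuous_sigma fun i => (f i).map.continuous))⟩, rfl⟩

theorem wedgeDesc_wedgeIncl {X : ι → PtdTop.{u}} {Z : PtdTop.{v}} (f : ∀ i, Hom (X i) Z) (i : ι)
    (x : X i) : (wedgeDesc f).map ((wedgeIncl X i).map x) = (f i).map x :=
  rfl

theorem wedge_hom_ext {X : ι → PtdTop.{u}} {Z : PtdTop.{v}} {f g : Hom (wedge X) Z}
    (h : ∀ i x, f.map ((wedgeIncl X i).map x) = g.map ((wedgeIncl X i).map x)) : f = g := by
  apply Hom.ext
  ext x
  obtain ⟨x | ⟨i, x⟩, rfl⟩ := Quot.exists_rep x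
  · exact f.map_pt.trans g.map_pt.symm
  · exact h i x

theorem wedgeIncl_eq_pt {X : ι → PtdTop.{u}} (i : ι) [Subsingleton (X i)] (x : X i) :
    (wedgeIncl X i).map x = (wedge X).pt := by
  rw [Subsingleton.elim x (X i).pt, (wedgeIncl X i).map_pt]

theorem subsingleton_wedge (X : ι → PtdTop.{u}) (h : ∀ i, Subsingleton (X i)) :
    Subsingleton (wedge X) := by
  have : Hom.id (wedge X) = Hom.const _ _ := wedge_hom_ext fun i x => wedgeIncl_eq_pt i x
  have h (x : wedge X) : x = (wedge X).pt := congrArg (fun k => k.map x) this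
  exact ⟨fun x y => (h x).trans (h y).symm⟩

end Wedge

/-! ### Maps between homotopy limits -/

section Holim

variable {C : Type u₁} [Category.{v₁} C] {C' : Type u₂} [Category.{v₂} C']

theorem holim_ext {D : C ⥤ PtdTop.{w}} {φ ψ : holim D} (h : ∀ c x, φ.1 c x = ψ.1 c x) : φ = ψ :=
  Subtype.ext (funext fun c => ContinuousMap.ext (h c))

/-- The map `|N(C' / c)| → |N(C / F c)|` induced by a functor `F : C' ⥤ C`. -/
noncomputable def overNerveFunctor (F : C' ⥤ C) (c : C') : C(overNerve c, overNerve (F.obj c)) :=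
  nerveTopMap (Over.post F)

theorem overNerveMap_apply {c d : C} (g : c ⟶ d) (x : overNerve c) :
    overNerveMap g x = nerveTopMap (Over.map g) x :=
  congrArg (fun k => k x) (toTop_map_nerveMap (Over.map g))

theorem overNerveFunctor_naturality (F : C' ⥤ C) {c d : C'} (g : c ⟶ d) (x : overNerve c) :
    overNerveFunctor F d (overNerveMap g x) = overNerveMap (F.map g) (overNerveFunctor F c x) := by
  have h : Over.map g ⋙ Over.post F = Over.post F ⋙ Over.map (F.map g) := by
    have hobj (A : Over c) :
        (Over.map g ⋙ Over.post F).obj A = (Over.post F ⋙ Over.map (F.map g)).obj A :=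
      congrArg Over.mk (F.map_comp A.hom g)
    refine CategoryTheory.Functor.ext hobj fun A B k => ?_
    apply Over.OverMorphism.ext
    rw [Over.comp_left, Over.comp_left, Over.eqToHom_left, Over.eqToHom_left]
    exact ((Category.id_comp _).trans (Category.comp_id _)).symm
  rw [overNerveMap_apply, overNerveMap_apply]
  have := congrArg nerveTopMap h
  rw [nerveTopMap_comp, nerveTopMap_comp] at this
  exact congrArg (fun k => k x) this

/-- The map `holim D → holim E` induced by a functor `F` between the index categories and a natural
family of maps `α c : D (F c) → E c`. -/
noncomputable def holimMap {D : C ⥤ PtdTop.{w₁}} {E : C' ⥤ PtdTop.{w₂}} (F : C' ⥤ C)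
    (α : ∀ c, Hom (D.obj (F.obj c)) (E.obj c))
    (hα : ∀ (c d : C') (g : c ⟶ d),
      Hom.comp (α d) (D.map (F.map g)) = Hom.comp (E.map g) (α c)) :
    Hom (holim D) (holim E) where
  map :=
    { toFun φ := ⟨fun c => (α c).map.comp ((φ.1 (F.obj c)).comp (overNerveFunctor F c)), by
        intro c d g x
        have h := congrArg (fun k => k.map (φ.1 (F.obj c) (overNerveFunctor F c x))) (hα c d g)
        refine Eq.trans ?_ h
        simp only [ContinuousMap.comp_apply, overNerveFunctor_naturality, φ.2]
        rfl⟩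
      continuous_toFun := by
        refine Continuous.subtype_mk (continuous_pi fun c => ?_) _
        exact (ContinuousMap.continuous_postcomp _).comp ((ContinuousMap.continuous_precomp _).comp
          ((continuous_apply _).comp continuous_subtype_val)) }
  map_pt := holim_ext fun c _ => (α c).map_pt

/-- If `φ` and `ψ` are points of `holim D`, the family that agrees with `φ` where `p` holds and with
`ψ` elsewhere is natural, provided that every morphism between the two regions ends at an object
with trivial value. -/
noncomputable def holimGlue (D : C ⥤ PtdTop.{w}) (p : C → Prop)
    (hp : ∀ (c d : C), (c ⟶ d) → (p c ↔ p d) ∨ Subsingleton (D.obj d)) :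
    Hom ((holim D).prod (holim D)) (holim D) where
  map :=
    { toFun φ := ⟨fun c => open Classical in if p c then φ.1.1 c else φ.2.1 c, by
        intro c d g x
        obtain h | h := hp c d g
        · by_cases hd : p d
          · simp only [h, hd, if_true]
            exact φ.1.2 c d g x
          · simp only [h, hd, if_false]
            exact φ.2.2 c d g x
        · exact Subsingleton.elim _ _⟩
      continuous_toFun := by
        refine Continuous.subtype_mk (continuous_pi fun c => ?_) _
        by_cases hc : p c
        · simp only [hc, if_true]
          exact (continuous_apply c).comp (continuous_subtype_val.comp continuous_fst)
        · simp only [hc, if_false]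
          exact (continuous_apply c).comp (continuous_subtype_val.comp continuous_snd) }
  map_pt := holim_ext fun c x => by
    classical exact congrArg (fun ψ : C(overNerve c, D.obj c) => ψ x) (ite_self _)

theorem holimGlue_of_pos (D : C ⥤ PtdTop.{w}) (p : C → Prop)
    (hp : ∀ (c d : C), (c ⟶ d) → (p c ↔ p d) ∨ Subsingleton (D.obj d))
    (φ ψ : holim D) {c : C} (hc : p c) : ((holimGlue D p hp).map (φ, ψ)).1 c = φ.1 c :=
  by classical exact if_pos hc

theorem holimGlue_of_neg (D : C ⥤ PtdTop.{w}) (p : C → Prop)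
    (hp : ∀ (c d : C), (c ⟶ d) → (p c ↔ p d) ∨ Subsingleton (D.obj d))
    (φ ψ : holim D) {c : C} (hc : ¬ p c) : ((holimGlue D p hp).map (φ, ψ)).1 c = ψ.1 c :=
  by classical exact if_neg hc

/-- Let `F` and `G` be functors in opposite directions and `k : F (G c) ⟶ c` such that `F ∘ G` fixes
every object over `c`. Then the composite of the maps induced by `F` and `G` is the identity
at the coordinate `c`, if the maps `α` and `β` compose to `D k` there: as the composite
`C / c ⥤ C / F (G c) ⥤ C / c` is the identity, this follows from naturality along `k`. -/
theorem holimMap_holimMap {D : C ⥤ PtdTop.{w₁}} {E : C' ⥤ PtdTop.{w₂}} [Quiver.IsThin C]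
    (F : C' ⥤ C) (G : C ⥤ C')
    (α : ∀ c, Hom (D.obj (F.obj c)) (E.obj c))
    (hα : ∀ (c d : C') (g : c ⟶ d),
      Hom.comp (α d) (D.map (F.map g)) = Hom.comp (E.map g) (α c))
    (β : ∀ c, Hom (E.obj (G.obj c)) (D.obj c))
    (hβ : ∀ (c d : C) (g : c ⟶ d),
      Hom.comp (β d) (E.map (G.map g)) = Hom.comp (D.map g) (β c))
    (φ : holim D) (c : C) (k : F.obj (G.obj c) ⟶ c)
    (hk : Hom.comp (β c) (α (G.obj c)) = D.map k)
    (hc : ∀ d : C, (d ⟶ c) → F.obj (G.obj d) = d) :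
    ((holimMap G β hβ).map ((holimMap F α hα).map φ)).1 c = φ.1 c := by
  ext x
  have h : Over.post G ⋙ Over.post F ⋙ Over.map k = 𝟭 (Over c) := by
    have hthin (A B : Over c) : Subsingleton (A ⟶ B) :=
      ⟨fun f g => Over.OverMorphism.ext (Subsingleton.elim _ _)⟩
    have hext (A B : Over c) (hAB : A.left = B.left) : A = B := by
      obtain ⟨a, ⟨⟨⟩⟩, f⟩ := A
      obtain ⟨b, ⟨⟨⟩⟩, g⟩ := B
      obtain rfl : a = b := hAB
      rw [Subsingleton.elim f g]
    exact CategoryTheory.Functor.ext (fun A => hext _ _ (hc A.left A.hom))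
      fun A B f => Subsingleton.elim _ _
  have hx : overNerveMap k (overNerveFunctor F (G.obj c) (overNerveFunctor G c x)) = x := by
    have := congrArg nerveTopMap h
    rw [nerveTopMap_comp, nerveTopMap_comp, nerveTopMap_id] at this
    rw [overNerveMap_apply]
    exact congrArg (fun k => k x) this
  have h := congrArg
    (fun j => j.map (φ.1 _ (overNerveFunctor F (G.obj c) (overNerveFunctor G c x)))) hk
  refine Eq.trans h ?_
  rw [← φ.2, hx]

end Holim

end PtdTop

namespace PtdTop

/-! ### Wedges of summands indexed by a face -/

section FaceWedge

variable {V : Type u} {V' : Type v} [DecidableEq V] [DecidableEq V']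

/-- The `i`-th summand of the wedge attached to a face `σ`: it is `X i` if `i ∈ σ`, and a point
otherwise. -/
abbrev faceSummand (X : V → PtdTop.{w}) (σ : Finset V) (i : V) : PtdTop.{w} :=
  select (X i) point (decide (i ∈ σ))

theorem subsingleton_faceSummand (X : V → PtdTop.{w}) {σ : Finset V} {i : V} (hi : i ∉ σ) :
    Subsingleton (faceSummand X σ i) := by
  rw [faceSummand, decide_eq_false hi]
  exact inferInstanceAs (Subsingleton PUnit)

theorem wedgeIncl_eq_pt_of_notMem (X : V → PtdTop.{w}) {σ : Finset V} {i : V} (hi : i ∉ σ)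
    (x : faceSummand X σ i) : (wedgeIncl (faceSummand X σ) i).map x = (wedge _).pt :=
  have := subsingleton_faceSummand X hi
  wedgeIncl_eq_pt i x

variable (e : V' ↪ V) (X : V → PtdTop.{w})

theorem decide_mem_le {σ : Finset V} {ρ : Finset V'} {i : V} {j : V'} (h : j ∈ ρ → i ∈ σ) :
    decide (j ∈ ρ) ≤ decide (i ∈ σ) := by
  simpa [Bool.le_iff_imp] using h

/-- The map of wedges that includes the summands indexed by `V'` into those indexed by `V`. -/
def faceWedgeIncl {σ : Finset V} {ρ : Finset V'} (h : ∀ j, e j ∈ σ → j ∈ ρ) :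
    Hom (wedge (faceSummand (fun j => X (e j)) ρ)) (wedge (faceSummand X σ)) :=
  wedgeDesc fun j => (wedgeIncl (faceSummand X σ) (e j)).comp
    (selectMap (X (e j)).toPoint _ _ (decide_mem_le (h j)))

open Classical in
/-- The map of wedges that collapses the summands whose index is not in `V'`. -/
noncomputable def faceWedgeCollapse {σ : Finset V} {ρ : Finset V'} (h : ∀ j, j ∈ ρ → e j ∈ σ) :
    Hom (wedge (faceSummand X σ)) (wedge (faceSummand (fun j => X (e j)) ρ)) :=
  wedgeDesc fun i =>
    if hi : ∃ j, e j = i then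
      hi.choose_spec ▸ (wedgeIncl (faceSummand (fun j => X (e j)) ρ) hi.choose).comp
        (selectMap (X (e hi.choose)).toPoint _ _ (decide_mem_le (h hi.choose)))
    else Hom.const _ _

variable {e X}

theorem faceWedgeIncl_apply {σ : Finset V} {ρ : Finset V'} (h : ∀ j, e j ∈ σ → j ∈ ρ) (j : V')
    (x : faceSummand (fun j => X (e j)) ρ j) :
    (faceWedgeIncl e X h).map ((wedgeIncl _ j).map x) =
      (wedgeIncl (faceSummand X σ) (e j)).map
        ((selectMap (X (e j)).toPoint _ _ (decide_mem_le (h j))).map x) :=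
  rfl

theorem faceWedgeCollapse_apply {σ : Finset V} {ρ : Finset V'} (h : ∀ j, j ∈ ρ → e j ∈ σ) (j : V')
    (x : faceSummand X σ (e j)) :
    (faceWedgeCollapse e X h).map ((wedgeIncl _ (e j)).map x) =
      (wedgeIncl (faceSummand (fun j => X (e j)) ρ) j).map
        ((selectMap (X (e j)).toPoint _ _ (decide_mem_le (h j))).map x) := by
  have hj : ∃ j', e j' = e j := ⟨j, rfl⟩
  rw [faceWedgeCollapse, wedgeDesc_wedgeIncl, dif_pos hj]
  -- The chosen preimage of `e j` is `j`, but only propositionally, so the transport is removed by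
  -- generalising over it.
  have key (j' : V') (hj' : e j' = e j) :
      (hj' ▸ (wedgeIncl (faceSummand (fun j => X (e j)) ρ) j').comp
        (selectMap (X (e j')).toPoint _ _ (decide_mem_le (h j'))) :
        Hom (faceSummand X σ (e j)) _) = (wedgeIncl (faceSummand (fun j => X (e j)) ρ) j).comp
        (selectMap (X (e j)).toPoint _ _ (decide_mem_le (h j))) := by
    obtain rfl := e.injective hj'
    rfl
  exact congrArg (fun k => k.map x) (key _ hj.choose_spec)

theorem faceWedgeCollapse_apply_of_notMem_range {σ : Finset V} {ρ : Finset V'}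
    (h : ∀ j, j ∈ ρ → e j ∈ σ) {i : V} (hi : ¬ ∃ j, e j = i) (x : faceSummand X σ i) :
    (faceWedgeCollapse e X h).map ((wedgeIncl _ i).map x) = (wedge _).pt := by
  rw [faceWedgeCollapse, wedgeDesc_wedgeIncl, dif_neg hi]
  rfl

/-- The map of wedges that collapses the summands indexed by `σ \ τ`. -/
def faceWedgeRestrict (X : V → PtdTop.{w}) {σ τ : Finset V} (h : ∀ i, i ∈ τ → i ∈ σ) :
    Hom (wedge (faceSummand X σ)) (wedge (faceSummand X τ)) :=
  wedgeMap fun i => selectMap (X i).toPoint _ _ (decide_mem_le (h i))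

theorem faceWedgeRestrict_apply {σ τ : Finset V} (h : ∀ i, i ∈ τ → i ∈ σ) (i : V)
    (x : faceSummand X σ i) :
    (faceWedgeRestrict X h).map ((wedgeIncl _ i).map x) =
      (wedgeIncl (faceSummand X τ) i).map
        ((selectMap (X i).toPoint _ _ (decide_mem_le (h i))).map x) :=
  rfl

theorem selectMap_selectMap {Y A : PtdTop.{w}} (f : Y ⟶ A) {p q r : Bool} (h : q ≤ p) (h' : r ≤ q)
    (x : select Y A p) :
    (selectMap f q r h').map ((selectMap f p q h).map x) = (selectMap f p r (h'.trans h)).map x :=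
  (congrArg (fun k => k.map x) (selectMap_comp f p q r h h')).symm

theorem faceWedgeIncl_naturality {σ τ : Finset V} {ρ π : Finset V'} (hσ : ∀ j, e j ∈ σ → j ∈ ρ)
    (hτ : ∀ j, e j ∈ τ → j ∈ π) (h : ∀ i, i ∈ τ → i ∈ σ) (h' : ∀ j, j ∈ π → j ∈ ρ) :
    (faceWedgeIncl e X hτ).comp (faceWedgeRestrict (fun j => X (e j)) h') =
      (faceWedgeRestrict X h).comp (faceWedgeIncl e X hσ) := by
  refine wedge_hom_ext fun j x => ?_
  simp only [Hom.comp, ContinuousMap.comp_apply, faceWedgeIncl_apply, faceWedgeRestrict_apply,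
    selectMap_selectMap]

theorem faceWedgeCollapse_naturality {σ τ : Finset V} {ρ π : Finset V'}
    (hσ : ∀ j, j ∈ ρ → e j ∈ σ) (hτ : ∀ j, j ∈ π → e j ∈ τ) (h : ∀ i, i ∈ τ → i ∈ σ)
    (h' : ∀ j, j ∈ π → j ∈ ρ) :
    (faceWedgeCollapse e X hτ).comp (faceWedgeRestrict X h) =
      (faceWedgeRestrict (fun j => X (e j)) h').comp (faceWedgeCollapse e X hσ) := by
  refine wedge_hom_ext fun i x => ?_
  by_cases hi : ∃ j, e j = i
  · obtain ⟨j, rfl⟩ := hi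
    simp only [Hom.comp, ContinuousMap.comp_apply, faceWedgeCollapse_apply, faceWedgeRestrict_apply,
      selectMap_selectMap]
  · simp only [Hom.comp, ContinuousMap.comp_apply, faceWedgeRestrict_apply,
      faceWedgeCollapse_apply_of_notMem_range _ hi]
    exact (faceWedgeRestrict _ h').map_pt.symm

/-- Collapsing and including again is the map of the diagram, if the smaller face lies in `V'`: the
summands outside `V'` then become points. -/
theorem faceWedgeIncl_comp_faceWedgeCollapse {σ τ : Finset V} {ρ : Finset V'}
    (hσ : ∀ j, j ∈ ρ → e j ∈ σ) (hτ : ∀ j, e j ∈ τ → j ∈ ρ) (h : ∀ i, i ∈ τ → i ∈ σ)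
    (hr : ∀ i ∈ τ, ∃ j, e j = i) :
    (faceWedgeIncl e X hτ).comp (faceWedgeCollapse e X hσ) = faceWedgeRestrict X h := by
  refine wedge_hom_ext fun i x => ?_
  by_cases hi : ∃ j, e j = i
  · obtain ⟨j, rfl⟩ := hi
    simp only [Hom.comp, ContinuousMap.comp_apply, faceWedgeCollapse_apply, faceWedgeRestrict_apply,
      faceWedgeIncl_apply, selectMap_selectMap]
  · simp only [Hom.comp, ContinuousMap.comp_apply, faceWedgeRestrict_apply,
      faceWedgeCollapse_apply_of_notMem_range _ hi]
    rw [wedgeIncl_eq_pt_of_notMem X fun h => hi (hr i h)]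
    exact (faceWedgeIncl e X hτ).map_pt

theorem faceWedgeCollapse_comp_faceWedgeIncl {σ : Finset V} {ρ π : Finset V'}
    (hσ : ∀ j, e j ∈ σ → j ∈ ρ) (hπ : ∀ j, j ∈ π → e j ∈ σ) (h : ∀ j, j ∈ π → j ∈ ρ) :
    (faceWedgeCollapse e X hπ).comp (faceWedgeIncl e X hσ) =
      faceWedgeRestrict (fun j => X (e j)) h := by
  refine wedge_hom_ext fun j x => ?_
  simp only [Hom.comp, ContinuousMap.comp_apply, faceWedgeCollapse_apply, faceWedgeRestrict_apply,
    faceWedgeIncl_apply, selectMap_selectMap]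

end FaceWedge

end PtdTop

namespace PreAbstractSimplicialComplex

open PtdTop

/-! ### Comparison with the polyhedral coproduct of a subcomplex -/

section Subcomplex

variable {V : Type u} {V' : Type v} [DecidableEq V] [DecidableEq V'] {e : V' ↪ V}
  {K : PreAbstractSimplicialComplex V} {L : PreAbstractSimplicialComplex V'}

instance (K : PreAbstractSimplicialComplex V) : Quiver.IsThin (Face K)ᵒᵖ := fun _ _ =>
  ⟨fun _ _ => Quiver.Hom.unop_inj (Subsingleton.elim _ _)⟩

/-- The value of the diagram at the empty face is a wedge of points. -/
theorem subsingleton_coproductDiagram_of_eq_empty (K : PreAbstractSimplicialComplex V)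
    (X : V → PtdTop.{w}) (σ : (Face K)ᵒᵖ)
    (hσ : σ.unop.1 = ∅) :
    Subsingleton ((coproductDiagram (fun i => (X i).toPoint) K).obj σ) :=
  subsingleton_wedge _ fun i => subsingleton_faceSummand X (by simp [hσ])

variable (e K L) in
/-- The injection `e` identifies `L` with the full subcomplex of `K` on the image of `e`. -/
structure IsFullSubcomplex : Prop where
  map_mem {σ : Finset V'} : σ = ∅ ∨ σ ∈ L → σ.map e = ∅ ∨ σ.map e ∈ K
  preimage_mem {σ : Finset V} : σ = ∅ ∨ σ ∈ K →
    σ.preimage e e.injective.injOn = ∅ ∨ σ.preimage e e.injective.injOn ∈ L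

namespace IsFullSubcomplex

variable (h : IsFullSubcomplex e K L) (X : V → PtdTop.{w})

/-- The functor on face posets that sends a face of `L` to its image in `K`. -/
def mapFace : (Face L)ᵒᵖ ⥤ (Face K)ᵒᵖ :=
  Functor.op <| Monotone.functor (f := fun σ : Face L => (⟨σ.1.map e, h.map_mem σ.2⟩ : Face K))
    fun _ _ hσ => Finset.map_subset_map.2 hσ

/-- The functor on face posets that intersects a face of `K` with `L`. -/
noncomputable def preimageFace : (Face K)ᵒᵖ ⥤ (Face L)ᵒᵖ :=
  Functor.op <| Monotone.functor (f := fun σ : Face K =>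
    (⟨σ.1.preimage e e.injective.injOn, h.preimage_mem σ.2⟩ : Face L))
    fun σ τ (hσ : σ.1 ⊆ τ.1) => show Finset.preimage _ _ _ ⊆ Finset.preimage _ _ _ from
      Finset.monotone_preimage e.injective hσ

/-- The map from the polyhedral coproduct of `K` to that of `L` that restricts a family to the faces
of `L` and collapses the summands outside `V'`. -/
noncomputable def restrict :
    Hom (K.polyhedralCoproductPt X) (L.polyhedralCoproductPt fun j => X (e j)) :=
  holimMap h.mapFace
    (fun σ => faceWedgeCollapse e X (σ := σ.unop.1.map e) (ρ := σ.unop.1) fun _ hj =>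
      (Finset.mem_map' e).2 hj)
    fun _ _ g => faceWedgeCollapse_naturality _ _ (fun _ hi => leOfHom (h.mapFace.map g).unop hi)
      fun _ hj => leOfHom g.unop hj

/-- The map from the polyhedral coproduct of `L` to that of `K` that evaluates a family at the
intersection of a face of `K` with `L`. -/
noncomputable def extend :
    Hom (L.polyhedralCoproductPt fun j => X (e j)) (K.polyhedralCoproductPt X) :=
  holimMap h.preimageFace
    (fun σ => faceWedgeIncl e X (σ := σ.unop.1) (ρ := σ.unop.1.preimage e e.injective.injOn)
      fun _ hj => Finset.mem_preimage.2 hj)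
    fun _ _ g => faceWedgeIncl_naturality _ _ (fun _ hi => leOfHom g.unop hi)
      fun _ hj => leOfHom (h.preimageFace.map g).unop hj

/-- The restriction to `L` depends only on the coordinates at the nonempty faces of `L`. -/
theorem restrict_congr {φ ψ : K.polyhedralCoproductPt X}
    (hφψ : ∀ σ : (Face L)ᵒᵖ, σ.unop.1.Nonempty →
      φ.1 (h.mapFace.obj σ) = ψ.1 (h.mapFace.obj σ)) :
    (h.restrict X).map φ = (h.restrict X).map ψ := by
  refine holim_ext fun σ x => ?_
  obtain hσ | hσ := σ.unop.1.eq_empty_or_nonempty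
  · have := subsingleton_coproductDiagram_of_eq_empty L (fun j => X (e j)) σ hσ
    exact Subsingleton.elim _ _
  · exact congrArg (fun ξ : C(overNerve _, _) =>
      (faceWedgeCollapse e X fun _ hj => (Finset.mem_map' e).2 hj).map
        (ξ (overNerveFunctor h.mapFace σ x))) (hφψ σ hσ)

theorem restrict_extend (φ : L.polyhedralCoproductPt fun j => X (e j)) :
    (h.restrict X).map ((h.extend X).map φ) = φ := by
  have hself (σ : (Face L)ᵒᵖ) : h.preimageFace.obj (h.mapFace.obj σ) = σ :=
    Opposite.unop_injective (Subtype.ext (Finset.preimage_map e σ.unop.1))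
  refine Subtype.ext (funext fun σ => ?_)
  refine holimMap_holimMap _ _ _ _ _ _ φ σ (eqToHom (hself σ)) ?_ fun τ _ => hself τ
  exact faceWedgeCollapse_comp_faceWedgeIncl _ _ fun j hj =>
    leOfHom (eqToHom (hself σ)).unop hj

/-- A point of the polyhedral coproduct of `K` is recovered from its restriction to `L` at each face
`σ` all of whose cofaces lie in `L`. -/
theorem extend_restrict_apply (φ : K.polyhedralCoproductPt X) (σ : (Face K)ᵒᵖ)
    (hσ : ∀ τ : Face K, σ.unop.1 ⊆ τ.1 → ∀ i ∈ τ.1, ∃ j, e j = i) :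
    ((h.extend X).map ((h.restrict X).map φ)).1 σ = φ.1 σ := by
  have hself (τ : (Face K)ᵒᵖ) (g : τ ⟶ σ) : h.mapFace.obj (h.preimageFace.obj τ) = τ := by
    refine Opposite.unop_injective (Subtype.ext ?_)
    change (τ.unop.1.preimage e e.injective.injOn).map e = τ.unop.1
    ext i
    simp only [Finset.mem_map, Finset.mem_preimage]
    constructor
    · rintro ⟨j, hj, rfl⟩
      exact hj
    · intro hi
      obtain ⟨j, rfl⟩ := hσ τ.unop (leOfHom g.unop) i hi
      exact ⟨j, hi, rfl⟩
  refine holimMap_holimMap _ _ _ _ _ _ φ σ (eqToHom (hself σ (𝟙 σ))) ?_ hself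
  exact faceWedgeIncl_comp_faceWedgeCollapse _ _
    (fun i hi => leOfHom (eqToHom (hself σ (𝟙 σ))).unop hi) (hσ σ.unop subset_rfl)

end IsFullSubcomplex

end Subcomplex

/-! ### The disjoint union -/

section DisjUnion

variable {V₁ : Type u} {V₂ : Type v} [DecidableEq V₁] [DecidableEq V₂]
  {K₁ : PreAbstractSimplicialComplex V₁} {K₂ : PreAbstractSimplicialComplex V₂}

theorem mem_disjUnion {σ : Finset (V₁ ⊕ V₂)} : σ ∈ K₁.disjUnion K₂ ↔
    (∃ ρ ∈ K₁, ρ.map .inl = σ) ∨ ∃ ρ ∈ K₂, ρ.map .inr = σ := by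
  simp only [Finset.map_eq_image]
  rfl

theorem isFullSubcomplex_inl : IsFullSubcomplex .inl (K₁.disjUnion K₂) K₁ where
  map_mem {σ} hσ := hσ.imp (by rintro rfl; rfl) fun hσ => mem_disjUnion.2 (.inl ⟨σ, hσ, rfl⟩)
  preimage_mem {σ} hσ := by
    rw [mem_disjUnion] at hσ
    obtain rfl | ⟨ρ, hρ, rfl⟩ | ⟨ρ, hρ, rfl⟩ := hσ
    · exact .inl Finset.preimage_empty
    · exact .inr (by rwa [Finset.preimage_map])
    · exact .inl (by ext; simp)

theorem isFullSubcomplex_inr : IsFullSubcomplex .inr (K₁.disjUnion K₂) K₂ where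
  map_mem {σ} hσ := hσ.imp (by rintro rfl; rfl) fun hσ => mem_disjUnion.2 (.inr ⟨σ, hσ, rfl⟩)
  preimage_mem {σ} hσ := by
    rw [mem_disjUnion] at hσ
    obtain rfl | ⟨ρ, hρ, rfl⟩ | ⟨ρ, hρ, rfl⟩ := hσ
    · exact .inl Finset.preimage_empty
    · exact .inl (by ext; simp)
    · exact .inr (by rwa [Finset.preimage_map])

/-- The face `σ` of the disjoint union contains a vertex of `V₁`. -/
def MeetsLeft (σ : (Face (K₁.disjUnion K₂))ᵒᵖ) : Prop := ∃ i, Sum.inl i ∈ σ.unop.1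

theorem face_eq_map (σ : Face (K₁.disjUnion K₂)) :
    (∃ ρ : Finset V₁, ρ.map .inl = σ.1) ∨ ∃ ρ : Finset V₂, ρ.map .inr = σ.1 := by
  obtain ⟨σ, rfl | hσ⟩ := σ
  · exact .inl ⟨∅, rfl⟩
  · exact (mem_disjUnion.1 hσ).imp (fun ⟨ρ, _, h⟩ => ⟨ρ, h⟩) fun ⟨ρ, _, h⟩ => ⟨ρ, h⟩

theorem exists_inl_of_inl_mem (σ : Face (K₁.disjUnion K₂)) {i : V₁} (hi : Sum.inl i ∈ σ.1) :
    ∀ j ∈ σ.1, ∃ k : V₁, Sum.inl k = j := by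
  obtain ⟨ρ, h⟩ | ⟨ρ, h⟩ := face_eq_map σ <;> rw [← h] at hi ⊢ <;> simp at hi ⊢

theorem exists_inr_of_inr_mem (σ : Face (K₁.disjUnion K₂)) {i : V₂} (hi : Sum.inr i ∈ σ.1) :
    ∀ j ∈ σ.1, ∃ k : V₂, Sum.inr k = j := by
  obtain ⟨ρ, h⟩ | ⟨ρ, h⟩ := face_eq_map σ <;> rw [← h] at hi ⊢ <;> simp at hi ⊢

/-- A face and a nonempty subface lie on the same side, which makes gluing possible. -/
theorem meetsLeft_iff_or_empty {σ τ : (Face (K₁.disjUnion K₂))ᵒᵖ} (g : σ ⟶ τ) :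
    (MeetsLeft σ ↔ MeetsLeft τ) ∨ τ.unop.1 = ∅ := by
  obtain h | ⟨j, hj⟩ := τ.unop.1.eq_empty_or_nonempty
  · exact .inr h
  have hτ : τ.unop.1 ⊆ σ.unop.1 := leOfHom g.unop
  refine .inl ⟨fun ⟨i, hi⟩ => ?_, fun ⟨i, hi⟩ => ⟨i, hτ hi⟩⟩
  obtain ⟨k, rfl⟩ := exists_inl_of_inl_mem _ hi j (hτ hj)
  exact ⟨k, hj⟩

variable (K₁ K₂) in
/-- Two points of the polyhedral coproduct of `K₁ ⊔ K₂` are combined into the one that agrees with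
the first on the faces meeting `V₁`, and with the second on the other faces. -/
noncomputable def coproductGlue (X : V₁ ⊕ V₂ → PtdTop.{w}) :
    Hom (((K₁.disjUnion K₂).polyhedralCoproductPt X).prod
      ((K₁.disjUnion K₂).polyhedralCoproductPt X)) ((K₁.disjUnion K₂).polyhedralCoproductPt X) :=
  holimGlue _ MeetsLeft fun _ τ g =>
    (meetsLeft_iff_or_empty g).imp_right (subsingleton_coproductDiagram_of_eq_empty _ X τ)

theorem coproductGlue_of_meetsLeft {X : V₁ ⊕ V₂ → PtdTop.{w}}
    (φ ψ : (K₁.disjUnion K₂).polyhedralCoproductPt X) {σ : (Face (K₁.disjUnion K₂))ᵒᵖ}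
    (hσ : MeetsLeft σ) : ((coproductGlue K₁ K₂ X).map (φ, ψ)).1 σ = φ.1 σ :=
  holimGlue_of_pos _ _ _ φ ψ hσ

theorem coproductGlue_of_not_meetsLeft {X : V₁ ⊕ V₂ → PtdTop.{w}}
    (φ ψ : (K₁.disjUnion K₂).polyhedralCoproductPt X) {σ : (Face (K₁.disjUnion K₂))ᵒᵖ}
    (hσ : ¬ MeetsLeft σ) : ((coproductGlue K₁ K₂ X).map (φ, ψ)).1 σ = ψ.1 σ :=
  holimGlue_of_neg _ _ _ φ ψ hσ

end DisjUnion

end PreAbstractSimplicialComplex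

theorem mainTheorem7 {V₁ : Type u} {V₂ : Type v} [Finite V₁] [Finite V₂]
    [DecidableEq V₁] [DecidableEq V₂] (X : V₁ ⊕ V₂ → PtdTop.{w})
    (K₁ : PreAbstractSimplicialComplex V₁) (K₂ : PreAbstractSimplicialComplex V₂) :
    ((K₁.disjUnion K₂).polyhedralCoproductPt X).HomotopyEquivalent
      ((K₁.polyhedralCoproductPt fun i => X (Sum.inl i)).prod
        (K₂.polyhedralCoproductPt fun i => X (Sum.inr i))) := by
  have h₁ := PreAbstractSimplicialComplex.isFullSubcomplex_inl (K₁ := K₁) (K₂ := K₂)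
  have h₂ := PreAbstractSimplicialComplex.isFullSubcomplex_inr (K₁ := K₁) (K₂ := K₂)
  refine PtdTop.HomotopyEquivalent.of_inverse
    ((h₁.restrict X).pair (h₂.restrict X))
    ((PreAbstractSimplicialComplex.coproductGlue K₁ K₂ X).comp
      ((h₁.extend X).prodMap (h₂.extend X)))
    (fun φ => ?_) fun ⟨φ, ψ⟩ => Prod.ext ?_ ?_
  · refine Subtype.ext (funext fun σ => ?_)
    by_cases hσ : PreAbstractSimplicialComplex.MeetsLeft σ
    · refine (PreAbstractSimplicialComplex.coproductGlue_of_meetsLeft _ _ hσ).trans ?_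
      obtain ⟨i, hi⟩ := hσ
      exact h₁.extend_restrict_apply X φ σ fun τ hτ =>
        PreAbstractSimplicialComplex.exists_inl_of_inl_mem τ (hτ hi)
    · refine (PreAbstractSimplicialComplex.coproductGlue_of_not_meetsLeft _ _ hσ).trans ?_
      obtain h | ⟨i | i, hi⟩ := σ.unop.1.eq_empty_or_nonempty
      · have := PreAbstractSimplicialComplex.subsingleton_coproductDiagram_of_eq_empty _ X σ h
        exact ContinuousMap.ext fun _ => Subsingleton.elim _ _
      · exact absurd ⟨i, hi⟩ hσ
      · exact h₂.extend_restrict_apply X φ σ fun τ hτ =>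
          PreAbstractSimplicialComplex.exists_inr_of_inr_mem τ (hτ hi)
  · refine (h₁.restrict_congr X fun σ hσ => ?_).trans (h₁.restrict_extend X φ)
    obtain ⟨i, hi⟩ := hσ
    exact PreAbstractSimplicialComplex.coproductGlue_of_meetsLeft _ _
      ⟨i, Finset.mem_map_of_mem _ hi⟩
  · refine (h₂.restrict_congr X fun σ _ => ?_).trans (h₂.restrict_extend X ψ)
    refine PreAbstractSimplicialComplex.coproductGlue_of_not_meetsLeft _ _ ?_
    rintro ⟨i, hi⟩
    obtain ⟨j, _, hj⟩ := Finset.mem_map.1 hi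
    exact Sum.inr_ne_inl hj
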